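/- Let $m,n$ be natural numbers, let $\varepsilon\ge 0$, let $\mathbf{x}$ be a random vector in $\mathbb{R}^n$, and let $U\subseteq\mathbb{R}^n$ be a nonempty bounded set with $\mathbb{P}[\mathbf{x}\in U]\ge 1-\varepsilon$. For $\rho>0$ let $N_U(\rho)$ be the least number of open Euclidean balls of radius $\rho$ with centers in $\mathbb{R}^n$ that cover $U$, and suppose that the lower Minkowski dimension $$\underline{\dim}_{\mathrm B}(U)=\liminf_{\rho\to 0}\frac{\log N_U(\rho)}{\log(1/\rho)}$$ satisfies $\underline{\dim}_{\mathrm B}(U)<m$. Then for Lebesgue-almost all matrices $A\in\mathbb{R}^{m\times n}$ there exists a decoder, i.e. a Borel measurable map $g:\mathbb{R}_{\ge 0}^m\to\mathbb{R}^n$ (which may depend on $A$), such that $$\mathbb{P}\big[g(|A\mathbf{x}|)\not\sim\mathbf{x}\big]\le\varepsilon.$$ Here $|v|$ denotes the vector of componentwise absolute values of $v\in\mathbb{R}^m$, and for $u,v\in\mathbb{R}^n$ one writes $u\sim v$ if $u=v$ or $u=-v$. -/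

import Mathlib

open Filter Topology MeasureTheory
open scoped NNReal Matrix

namespace PhaseRetrieval

/-- `N_U(ρ)`: the least number of open Euclidean balls of radius `ρ`, with arbitrary centers in
`ℝⁿ`, that cover `U`. For bounded `U` and `ρ > 0` such a finite cover always exists. -/
noncomputable def coveringNumber {n : ℕ} (U : Set (EuclideanSpace ℝ (Fin n))) (ρ : ℝ) : ℕ :=
  sInf {k : ℕ | ∃ c : Fin k → EuclideanSpace ℝ (Fin n), U ⊆ ⋃ i, Metric.ball (c i) ρ}

/-- The lower Minkowski (box-counting) dimension `liminf_{ρ → 0} log N_U(ρ) / log (1/ρ)` of a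
nonempty bounded set `U ⊆ ℝⁿ`, the limit inferior being taken in the extended reals. -/
noncomputable def lowerMinkowskiDim {n : ℕ} (U : Set (EuclideanSpace ℝ (Fin n))) : EReal :=
  liminf (fun ρ : ℝ => ((Real.log (coveringNumber U ρ) / Real.log (1 / ρ) : ℝ) : EReal)) (𝓝[>] 0)

/-- `u ∼ v`: equality up to a global sign. -/
def SignEquiv {n : ℕ} (u v : EuclideanSpace ℝ (Fin n)) : Prop :=
  u = v ∨ u = -v

/-- The phaseless measurements `|A u|` (componentwise absolute value), a vector of `m` nonnegative
real numbers. -/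
noncomputable def phaseless {m n : ℕ} (A : Matrix (Fin m) (Fin n) ℝ)
    (u : EuclideanSpace ℝ (Fin n)) : Fin m → ℝ≥0 :=
  fun i => Real.nnabs ((A *ᵥ (u : Fin n → ℝ)) i)

end PhaseRetrieval

namespace PhaseRetrieval

/-! ### Volume estimates for slabs -/

/-- The part of the slab `|a ⬝ᵥ w| ≤ t` inside the cube of radius `R`. -/
def cubeSlab {n : ℕ} (w : Fin n → ℝ) (R t : ℝ) : Set (Fin n → ℝ) :=
  {a | ‖a‖ ≤ R ∧ |a ⬝ᵥ w| ≤ t}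

theorem volume_cubeSlab_le {n : ℕ} {w : Fin n → ℝ} {R t δ : ℝ} (hR : 0 ≤ R) (ht : 0 ≤ t)
    (hδ : 0 < δ) (hw : δ ≤ ‖w‖) :
    volume (cubeSlab w R t) ≤ ENNReal.ofReal (2 * t / δ * (2 * R) ^ (n - 1)) := by
  obtain ⟨i, hi⟩ : ∃ i, δ ≤ |w i| := by
    by_contra! h
    exact absurd hw (not_le.2 ((pi_norm_lt_iff hδ).2 h))
  have hwi : 0 < |w i| := hδ.trans_le hi
  -- `M` replaces coordinate `i` of `a` by `a ⬝ᵥ w` and keeps the others, so the slab maps into a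
  -- box.
  set M : Matrix (Fin n) (Fin n) ℝ := ((1 : Matrix (Fin n) (Fin n) ℝ).updateCol i w)ᵀ with hM
  have hMdet : LinearMap.det (Matrix.toLin' M) = w i := by
    rw [LinearMap.det_toLin', hM, Matrix.det_transpose, ← Matrix.cramer_apply, Matrix.cramer_one]
    rfl
  have hMi (a : Fin n → ℝ) : Matrix.toLin' M a i = a ⬝ᵥ w := by
    rw [Matrix.toLin'_apply, Matrix.mulVec, dotProduct_comm]
    congr 1
    ext j
    simp [hM]
  have hMj (a : Fin n → ℝ) (j : Fin n) (hj : j ≠ i) : Matrix.toLin' M a j = a j := by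
    rw [Matrix.toLin'_apply, Matrix.mulVec, dotProduct, Finset.sum_eq_single j]
    · simp [hM, hj]
    · intro k _ hk
      simp [hM, hj, hk]
    · simp
  set c : Fin n → ℝ := Function.update (fun _ => R) i t with hc
  have hsub : cubeSlab w R t ⊆ Matrix.toLin' M ⁻¹' Set.Icc (-c) c := by
    rintro a ⟨ha, hat⟩
    rw [Set.mem_preimage, Set.mem_Icc, Pi.le_def, Pi.le_def, ← forall_and]
    intro j
    rw [Pi.neg_apply, ← abs_le]
    by_cases hj : j = i
    · subst hj
      simpa [hMi, hc] using hat
    · rw [hMj a j hj]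
      simpa [hc, hj] using (norm_le_pi_norm a j).trans ha
  have hne : LinearMap.det (Matrix.toLin' M) ≠ 0 := by
    rw [hMdet]; exact abs_pos.1 hwi
  have hprod : ∏ j, (c j - (-c) j) = 2 * t * (2 * R) ^ (n - 1) := by
    have : (fun j => c j - (-c) j) = Function.update (fun _ => 2 * R) i (2 * t) := by
      ext j
      by_cases hj : j = i
      · subst hj; simp [hc]; ring
      · simp [hc, hj]; ring
    simp only [this]
    rw [Finset.prod_update_of_mem (Finset.mem_univ i)]
    simp [Finset.card_sdiff]
  calc volume (cubeSlab w R t) ≤ volume (Matrix.toLin' M ⁻¹' Set.Icc (-c) c) :=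
        measure_mono hsub
    _ = ENNReal.ofReal (|w i|⁻¹ * (2 * t * (2 * R) ^ (n - 1))) := by
        rw [Measure.addHaar_preimage_linearMap _ hne, hMdet, Real.volume_Icc_pi,
          ← ENNReal.ofReal_prod_of_nonneg, hprod, ← ENNReal.ofReal_mul (abs_nonneg _), abs_inv]
        intro j _
        by_cases hj : j = i
        · subst hj; simp [hc]; linarith
        · simp [hc, hj]; linarith
    _ ≤ _ := by
        apply ENNReal.ofReal_le_ofReal
        rw [div_mul_eq_mul_div, inv_mul_eq_div]
        gcongr

theorem abs_dotProduct_le {n : ℕ} {a w : Fin n → ℝ} {R r : ℝ} (ha : ‖a‖ ≤ R)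
    (hw : ∀ i, |w i| ≤ r) : |a ⬝ᵥ w| ≤ n * (R * r) := by
  calc |a ⬝ᵥ w| ≤ ∑ i, |a i * w i| := Finset.abs_sum_le_sum_abs _ _
    _ ≤ ∑ _i : Fin n, R * r := by
        gcongr with i
        rw [abs_mul]
        exact mul_le_mul ((norm_le_pi_norm a i).trans ha) (hw i) (abs_nonneg _)
          ((norm_nonneg a).trans ha)
    _ = n * (R * r) := by simp

/-- `A` does not distinguish `u` from `v` although `u` and `v` are `δ`-far from being equal up to a
sign. -/
def Confused {m n : ℕ} (δ : ℝ) (A : Fin m → Fin n → ℝ) (u v : EuclideanSpace ℝ (Fin n)) : Prop :=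
  (∀ i, |A i ⬝ᵥ v.ofLp| = |A i ⬝ᵥ u.ofLp|) ∧ δ ≤ ‖v.ofLp - u.ofLp‖ ∧ δ ≤ ‖v.ofLp + u.ofLp‖

theorem volume_confused_closedBall_le {m n : ℕ} {R δ ρ : ℝ} (hR : 0 ≤ R) (hδ : 0 < δ)
    (hρ : 0 ≤ ρ) (u c : EuclideanSpace ℝ (Fin n)) :
    volume {A : Fin m → Fin n → ℝ | ‖A‖ ≤ R ∧ ∃ v ∈ Metric.closedBall c ρ, Confused δ A u v} ≤
      ENNReal.ofReal ((8 * n * R / δ * (2 * R) ^ (n - 1)) ^ m * ρ ^ m) := by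
  set T := {A : Fin m → Fin n → ℝ | ‖A‖ ≤ R ∧ ∃ v ∈ Metric.closedBall c ρ, Confused δ A u v}
  -- A single witness `w` in the ball fixes the two slabs; passing from any other `v` to `w` costs
  -- at most `t`.
  rcases T.eq_empty_or_nonempty with hT | ⟨A₀, hA₀, w, hwc, -, hw1, hw2⟩
  · simp [hT]
  set t : ℝ := n * (R * (2 * ρ)) with ht
  have ht0 : 0 ≤ t := by positivity
  set S : Set (Fin n → ℝ) :=
    cubeSlab (w.ofLp - u.ofLp) R t ∪ cubeSlab (w.ofLp + u.ofLp) R t with hS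
  have hsub : T ⊆ Set.univ.pi fun _ => S := by
    rintro A ⟨hA, v, hvc, hv, -, -⟩ i -
    have hAi : ‖A i‖ ≤ R := (norm_le_pi_norm A i).trans hA
    have hwv : |A i ⬝ᵥ (w.ofLp - v.ofLp)| ≤ t := by
      refine abs_dotProduct_le hAi fun j => ?_
      calc |(w - v).ofLp j| ≤ ‖w - v‖ := PiLp.norm_apply_le (w - v) j
        _ = dist w v := (dist_eq_norm w v).symm
        _ ≤ dist w c + dist v c := dist_triangle_right _ _ _
        _ ≤ 2 * ρ := by
          have h1 := Metric.mem_closedBall.1 hwc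
          have h2 := Metric.mem_closedBall.1 hvc
          linarith
    rw [dotProduct_sub] at hwv
    rcases abs_eq_abs.1 (hv i) with h | h
    · left
      refine ⟨hAi, ?_⟩
      rwa [dotProduct_sub, ← h]
    · right
      refine ⟨hAi, ?_⟩
      rwa [dotProduct_add, ← sub_neg_eq_add, ← h]
  have hSvol : volume S ≤ ENNReal.ofReal (8 * n * R / δ * (2 * R) ^ (n - 1) * ρ) := by
    refine (measure_union_le _ _).trans ((add_le_add (volume_cubeSlab_le hR ht0 hδ hw1)
      (volume_cubeSlab_le hR ht0 hδ hw2)).trans ?_)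
    rw [← ENNReal.ofReal_add (by positivity) (by positivity)]
    apply le_of_eq
    congr 1
    rw [ht]
    ring
  calc volume T ≤ volume (Set.univ.pi fun _ : Fin m => S) := measure_mono hsub
    _ = volume S ^ m := by rw [volume_pi_pi]; simp
    _ ≤ ENNReal.ofReal (8 * n * R / δ * (2 * R) ^ (n - 1) * ρ) ^ m := by gcongr
    _ = _ := by rw [← ENNReal.ofReal_pow (by positivity), mul_pow]

/-! ### Covering numbers and null sets -/

theorem exists_cover_coveringNumber {n : ℕ} {U : Set (EuclideanSpace ℝ (Fin n))}
    (hU : Bornology.IsBounded U) {ρ : ℝ} (hρ : 0 < ρ) :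
    ∃ c : Fin (coveringNumber U ρ) → EuclideanSpace ℝ (Fin n),
      U ⊆ ⋃ i, Metric.ball (c i) ρ := by
  refine Nat.sInf_mem
    (s := {k : ℕ | ∃ c : Fin k → EuclideanSpace ℝ (Fin n), U ⊆ ⋃ i, Metric.ball (c i) ρ}) ?_
  have htb : TotallyBounded U :=
    hU.isCompact_closure.totallyBounded.subset subset_closure
  obtain ⟨t, ht, hcov⟩ := Metric.totallyBounded_iff.1 htb ρ hρ
  lift t to Finset (EuclideanSpace ℝ (Fin n)) using ht
  refine ⟨t.card, fun i => t.equivFin.symm i, fun x hx => ?_⟩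
  obtain ⟨y, hy, hxy⟩ := Set.mem_iUnion₂.1 (hcov hx)
  exact Set.mem_iUnion.2 ⟨t.equivFin ⟨y, hy⟩, by simpa using hxy⟩

theorem frequently_coveringNumber_mul_pow_lt {m n : ℕ} {U : Set (EuclideanSpace ℝ (Fin n))}
    (hdim : lowerMinkowskiDim U < (m : EReal)) {η : ℝ} (hη : 0 < η) :
    ∃ᶠ ρ : ℝ in 𝓝[>] 0, coveringNumber U ρ * ρ ^ m < η := by
  obtain ⟨s, hs, hsm⟩ := EReal.lt_iff_exists_real_btwn.1 hdim
  have hsm' : s < m := by exact_mod_cast hsm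
  have hfreq := frequently_lt_of_liminf_lt (by isBoundedDefault) hs
  have hlim : Tendsto (fun ρ : ℝ => ρ ^ ((m : ℝ) - s)) (𝓝[>] 0) (𝓝 0) := by
    have h : Tendsto (fun ρ : ℝ => ρ ^ ((m : ℝ) - s)) (𝓝 0) (𝓝 (0 ^ ((m : ℝ) - s))) :=
      Real.continuousAt_rpow_const 0 _ (Or.inr (sub_nonneg.2 hsm'.le))
    rw [Real.zero_rpow (sub_pos.2 hsm').ne'] at h
    exact h.mono_left nhdsWithin_le_nhds
  have hev : ∀ᶠ ρ : ℝ in 𝓝[>] 0, ρ ^ ((m : ℝ) - s) < η ∧ ρ ∈ Set.Ioo (0 : ℝ) 1 :=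
    (hlim.eventually_lt_const hη).and (Ioo_mem_nhdsGT one_pos)
  refine (hfreq.and_eventually hev).mono ?_
  rintro ρ ⟨hlog, hlt, hρ0, hρ1⟩
  refine lt_of_le_of_lt ?_ hlt
  rw [EReal.coe_lt_coe_iff, div_lt_iff₀ (Real.log_pos (one_lt_one_div hρ0 hρ1)), one_div,
    Real.log_inv] at hlog
  have hN : (coveringNumber U ρ : ℝ) ≤ ρ ^ (-s) := by
    rcases Nat.eq_zero_or_pos (coveringNumber U ρ) with h | h
    · rw [h]; simpa using Real.rpow_nonneg hρ0.le _
    · rw [Real.rpow_def_of_pos hρ0, ← Real.log_le_iff_le_exp (by exact_mod_cast h)]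
      linarith
  calc coveringNumber U ρ * ρ ^ m ≤ ρ ^ (-s) * ρ ^ m := by gcongr
    _ = ρ ^ ((m : ℝ) - s) := by
      rw [← Real.rpow_natCast, ← Real.rpow_add hρ0]
      congr 1
      ring

theorem volume_confused_bounded_eq_zero {m n : ℕ} {U : Set (EuclideanSpace ℝ (Fin n))}
    (hU : Bornology.IsBounded U) (hdim : lowerMinkowskiDim U < (m : EReal)) {δ R : ℝ}
    (hδ : 0 < δ) (hR : 0 ≤ R) (u : EuclideanSpace ℝ (Fin n)) :
    volume {A : Fin m → Fin n → ℝ | ‖A‖ ≤ R ∧ ∃ v ∈ closure U, Confused δ A u v} = 0 := by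
  set C : ℝ := (8 * n * R / δ * (2 * R) ^ (n - 1)) ^ m with hC
  have hC0 : 0 ≤ C := by positivity
  have key (ρ : ℝ) (hρ : 0 < ρ) :
      volume {A : Fin m → Fin n → ℝ | ‖A‖ ≤ R ∧ ∃ v ∈ closure U, Confused δ A u v} ≤
        ENNReal.ofReal (C * (coveringNumber U ρ * ρ ^ m)) := by
    obtain ⟨c, hc⟩ := exists_cover_coveringNumber hU hρ
    -- Closed balls also cover the closure, whose compactness is needed for measurability later.
    have hcl : closure U ⊆ ⋃ i, Metric.closedBall (c i) ρ :=
      closure_minimal (hc.trans (Set.iUnion_mono fun i => Metric.ball_subset_closedBall))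
        (isClosed_iUnion_of_finite fun i => Metric.isClosed_closedBall)
    have hsub : {A : Fin m → Fin n → ℝ | ‖A‖ ≤ R ∧ ∃ v ∈ closure U, Confused δ A u v} ⊆
        ⋃ i, {A | ‖A‖ ≤ R ∧ ∃ v ∈ Metric.closedBall (c i) ρ, Confused δ A u v} := by
      rintro A ⟨hA, v, hv, hAv⟩
      obtain ⟨i, hi⟩ := Set.mem_iUnion.1 (hcl hv)
      exact Set.mem_iUnion.2 ⟨i, hA, v, hi, hAv⟩
    refine (measure_mono hsub).trans ((measure_iUnion_fintype_le _ _).trans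
      ((Finset.sum_le_sum fun i _ => volume_confused_closedBall_le hR hδ hρ.le u (c i)).trans ?_))
    rw [Finset.sum_const, Finset.card_univ, Fintype.card_fin, ← ENNReal.ofReal_nsmul, nsmul_eq_mul]
    apply le_of_eq
    congr 1
    ring
  refine le_antisymm (le_of_forall_pos_le_add fun η hη => ?_) zero_le
  rw [zero_add]
  rcases eq_or_ne η ⊤ with rfl | hηt
  · exact le_top
  have hη' : 0 < η.toReal := ENNReal.toReal_pos hη.ne' hηt
  -- Dividing by `C + 1` avoids the case `C = 0`.
  obtain ⟨ρ, hlt, hρ⟩ := ((frequently_coveringNumber_mul_pow_lt hdim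
    (div_pos hη' (by positivity : 0 < C + 1))).and_eventually self_mem_nhdsWithin).exists
  refine (key ρ hρ).trans (ENNReal.ofReal_le_of_le_toReal ?_)
  rw [lt_div_iff₀ (by positivity)] at hlt
  have : 0 ≤ coveringNumber U ρ * ρ ^ m := by
    have : (0 : ℝ) < ρ := hρ
    positivity
  linarith

theorem ae_forall_not_confused {m n : ℕ} {U : Set (EuclideanSpace ℝ (Fin n))}
    (hU : Bornology.IsBounded U) (hdim : lowerMinkowskiDim U < (m : EReal))
    {δ : ℝ} (hδ : 0 < δ) (u : EuclideanSpace ℝ (Fin n)) :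
    ∀ᵐ A : Fin m → Fin n → ℝ, ¬ ∃ v ∈ closure U, Confused δ A u v := by
  have h (k : ℕ) : ∀ᵐ A : Fin m → Fin n → ℝ,
      ¬ (‖A‖ ≤ k ∧ ∃ v ∈ closure U, Confused δ A u v) := by
    rw [ae_iff]
    simpa using volume_confused_bounded_eq_zero hU hdim hδ (Nat.cast_nonneg k) u
  filter_upwards [ae_all_iff.2 h] with A hA hv
  obtain ⟨k, hk⟩ := exists_nat_ge ‖A‖
  exact hA k ⟨hk, hv⟩

/-! ### Joint measurability, for Fubini -/

/-- Projection along a compact factor is a closed map. -/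
theorem isClosed_exists_confused {m n : ℕ} {K : Set (EuclideanSpace ℝ (Fin n))}
    (hK : IsCompact K) (δ : ℝ) :
    IsClosed {p : (Fin m → Fin n → ℝ) × EuclideanSpace ℝ (Fin n) |
      ∃ v ∈ K, Confused δ p.1 p.2 v} := by
  have : CompactSpace K := isCompact_iff_compactSpace.1 hK
  have hcl : IsClosed {q : ((Fin m → Fin n → ℝ) × EuclideanSpace ℝ (Fin n)) × K |
      Confused δ q.1.1 q.1.2 (q.2 : EuclideanSpace ℝ (Fin n))} := by
    simp only [Confused, Set.ofPred_and, Set.ofPred_forall, dotProduct]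
    refine (isClosed_iInter fun i => isClosed_eq ?_ ?_).inter
      ((isClosed_le ?_ ?_).inter (isClosed_le ?_ ?_)) <;> fun_prop
  convert isClosedMap_fst_of_compactSpace _ hcl using 1
  ext p
  constructor
  · rintro ⟨v, hv, h⟩
    exact ⟨(p, ⟨v, hv⟩), h, rfl⟩
  · rintro ⟨⟨q, v⟩, h, rfl⟩
    exact ⟨v, v.2, h⟩

/-- `u` is recovered up to a sign from `|A u|`, given that it lies in `K` up to a sign. -/
def Recoverable {m n : ℕ} (K : Set (EuclideanSpace ℝ (Fin n))) (A : Fin m → Fin n → ℝ)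
    (u : EuclideanSpace ℝ (Fin n)) : Prop :=
  ∀ k : ℕ, ¬ ∃ v ∈ K, Confused (1 / ((k : ℝ) + 1)) A u v

theorem measurableSet_recoverable {m n : ℕ} {K : Set (EuclideanSpace ℝ (Fin n))}
    (hK : IsCompact K) :
    MeasurableSet {p : (Fin m → Fin n → ℝ) × EuclideanSpace ℝ (Fin n) |
      Recoverable K p.1 p.2} := by
  simp only [Recoverable, Set.ofPred_forall]
  exact MeasurableSet.iInter fun k => (isClosed_exists_confused hK _).measurableSet.compl

theorem phaseless_eq_iff {m n : ℕ} {A : Fin m → Fin n → ℝ} {u v : EuclideanSpace ℝ (Fin n)} :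
    phaseless (Matrix.of A) v = phaseless (Matrix.of A) u ↔
      ∀ i, |A i ⬝ᵥ v.ofLp| = |A i ⬝ᵥ u.ofLp| := by
  rw [funext_iff]
  refine forall_congr' fun i => ?_
  rw [← NNReal.coe_inj]
  simp [phaseless, Matrix.mulVec]

theorem phaseless_neg {m n : ℕ} (A : Matrix (Fin m) (Fin n) ℝ) (u : EuclideanSpace ℝ (Fin n)) :
    phaseless A (-u) = phaseless A u := by
  ext i
  simp [phaseless, Matrix.mulVec_neg]

theorem continuous_phaseless {m n : ℕ} (A : Matrix (Fin m) (Fin n) ℝ) :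
    Continuous (phaseless A) := by
  refine continuous_pi fun i => ?_
  simp only [phaseless]
  simp only [← Real.toNNReal_abs, Matrix.mulVec, dotProduct]
  fun_prop

theorem Recoverable.signEquiv {m n : ℕ} {K : Set (EuclideanSpace ℝ (Fin n))}
    {A : Fin m → Fin n → ℝ} {u v : EuclideanSpace ℝ (Fin n)} (hu : Recoverable K A u)
    (hv : v ∈ K) (h : phaseless (Matrix.of A) v = phaseless (Matrix.of A) u) :
    SignEquiv v u := by
  by_contra hne
  rw [SignEquiv, not_or] at hne
  have h1 : 0 < ‖v.ofLp - u.ofLp‖ := by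
    rw [norm_pos_iff, sub_ne_zero]
    exact fun e => hne.1 (WithLp.ofLp_injective 2 e)
  have h2 : 0 < ‖v.ofLp + u.ofLp‖ := by
    rw [norm_pos_iff, ← sub_neg_eq_add, sub_ne_zero]
    exact fun e => hne.2 (WithLp.ofLp_injective 2 e)
  obtain ⟨k, hk⟩ := exists_nat_one_div_lt (lt_min h1 h2)
  exact hu k ⟨v, hv, phaseless_eq_iff.1 h, hk.le.trans (min_le_left _ _),
    hk.le.trans (min_le_right _ _)⟩

theorem Recoverable.neg {m n : ℕ} {K : Set (EuclideanSpace ℝ (Fin n))}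
    {A : Fin m → Fin n → ℝ} {u : EuclideanSpace ℝ (Fin n)} (hu : Recoverable K A u) :
    Recoverable K A (-u) := by
  rintro k ⟨v, hv, h1, h2, h3⟩
  refine hu k ⟨v, hv, fun i => ?_, ?_, ?_⟩
  · simpa using h1 i
  · simpa [← sub_eq_add_neg] using h3
  · simpa using h2

/-! ### Choice of sign and the decoder -/

/-- Vectors that vanish or whose first nonzero coordinate is positive. -/
def positiveHalf (n : ℕ) : Set (EuclideanSpace ℝ (Fin n)) :=
  {u | u = 0 ∨ ∃ i, (∀ j, j < i → u j = 0) ∧ 0 < u i}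

theorem measurableSet_positiveHalf (n : ℕ) : MeasurableSet (positiveHalf n) := by
  simp only [positiveHalf, Set.ofPred_or, Set.ofPred_exists, Set.ofPred_and, Set.ofPred_forall]
  refine (measurableSet_singleton 0).union (MeasurableSet.iUnion fun i =>
    (MeasurableSet.iInter fun j => MeasurableSet.iInter fun _ =>
      measurableSet_eq_fun ?_ ?_).inter (measurableSet_lt ?_ ?_)) <;> fun_prop

theorem mem_positiveHalf_or_neg_mem {n : ℕ} (u : EuclideanSpace ℝ (Fin n)) :
    u ∈ positiveHalf n ∨ -u ∈ positiveHalf n := by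
  rcases eq_or_ne u 0 with h | h
  · exact Or.inl (Or.inl h)
  have hex : ∃ i, u i ≠ 0 := by
    by_contra! h'
    exact h (PiLp.ext h')
  obtain ⟨i, hi, hmin⟩ := WellFounded.has_min (wellFounded_lt (α := Fin n)) {i | u i ≠ 0} hex
  have hz (j : Fin n) (hj : j < i) : u j = 0 := by
    by_contra hne
    exact hmin j hne hj
  rcases lt_or_gt_of_ne hi with h' | h'
  · exact Or.inr (Or.inr ⟨i, fun j hj => by simp [hz j hj], by simpa using h'⟩)
  · exact Or.inl (Or.inr ⟨i, hz, h'⟩)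

theorem eq_of_signEquiv_of_mem_positiveHalf {n : ℕ} {u v : EuclideanSpace ℝ (Fin n)}
    (hu : u ∈ positiveHalf n) (hv : v ∈ positiveHalf n) (h : SignEquiv u v) : u = v := by
  rcases h with h | rfl
  · exact h
  rcases hv with rfl | ⟨i, hi, hi'⟩
  · simp
  rcases hu with h | ⟨k, hk, hk'⟩
  · rw [h, neg_eq_zero.1 h]
  exfalso
  simp only [PiLp.neg_apply, neg_eq_zero, Left.neg_pos_iff] at hk hk'
  rcases lt_trichotomy i k with h | rfl | h
  · exact hi'.ne' (hk i h)
  · exact lt_asymm hi' hk'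
  · exact hk'.ne (hi k h)

theorem SignEquiv.neg_left {n : ℕ} {u v : EuclideanSpace ℝ (Fin n)} (h : SignEquiv (-u) v) :
    SignEquiv u v := by
  rcases h with rfl | h
  · exact Or.inr (neg_neg u).symm
  · exact Or.inl (neg_injective h)

theorem exists_measurable_decoder {m n : ℕ} {K : Set (EuclideanSpace ℝ (Fin n))}
    (hK : IsCompact K) (A : Fin m → Fin n → ℝ) :
    ∃ g : (Fin m → ℝ≥0) → EuclideanSpace ℝ (Fin n), Measurable g ∧
      ∀ u ∈ K, Recoverable K A u → SignEquiv (g (phaseless (Matrix.of A) u)) u := by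
  -- `-K` is included because the representative of `u ∈ K` in the half-space may be `-u`.
  set S : Set (EuclideanSpace ℝ (Fin n)) :=
    ({u | Recoverable K A u} ∩ (K ∪ -K)) ∩ positiveHalf n with hS
  have hSm : MeasurableSet S :=
    ((measurable_prodMk_left (measurableSet_recoverable hK)).inter
      (hK.measurableSet.union hK.measurableSet.neg)).inter (measurableSet_positiveHalf n)
  have : StandardBorelSpace S := hSm.standardBorel
  set f : S → Fin m → ℝ≥0 := fun u => phaseless (Matrix.of A) u with hf
  have hfm : Measurable f :=
    (continuous_phaseless (Matrix.of A)).measurable.comp measurable_subtype_coe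
  have hinj : Function.Injective f := by
    rintro ⟨u, ⟨hu, _⟩, huH⟩ ⟨v, ⟨_, hv⟩, hvH⟩ huv
    have huv' : phaseless (Matrix.of A) v = phaseless (Matrix.of A) u := huv.symm
    refine Subtype.ext (eq_of_signEquiv_of_mem_positiveHalf hvH huH ?_).symm
    rcases hv with hv | hv
    · exact hu.signEquiv hv huv'
    · exact (hu.signEquiv hv ((phaseless_neg _ _).trans huv')).neg_left
  -- Lusin–Souslin: an injective Borel map on a standard Borel space is a measurable embedding.
  obtain ⟨g, hg, hgf⟩ := (hfm.measurableEmbedding hinj).exists_measurable_extend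
    measurable_subtype_coe fun _ => ⟨(0 : EuclideanSpace ℝ (Fin n))⟩
  refine ⟨g, hg, fun u hu hrec => ?_⟩
  rcases mem_positiveHalf_or_neg_mem u with h | h
  · exact Or.inl (congrFun hgf ⟨u, ⟨hrec, Or.inl hu⟩, h⟩)
  · have := congrFun hgf ⟨-u, ⟨hrec.neg, Or.inr (by simpa using hu)⟩, h⟩
    simp only [hf, Function.comp_apply, phaseless_neg] at this
    exact Or.inr this

end PhaseRetrieval

/-- Lebesgue measure on `m × n` matrices is the volume of the space `Fin m → Fin n → ℝ` of entries.
For a set `U` that is not measurable, the probability `P[x ∈ U]` is read as an outer measure, the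
weakest reading of the hypothesis. -/
theorem proposition1 {Ω : Type*} [MeasurableSpace Ω] (P : Measure Ω) [IsProbabilityMeasure P]
    (m n : ℕ) (ε : ℝ) (hε : 0 ≤ ε)
    (x : Ω → EuclideanSpace ℝ (Fin n)) (hx : Measurable x)
    (U : Set (EuclideanSpace ℝ (Fin n))) (hU : U.Nonempty) (hUb : Bornology.IsBounded U)
    (hPU : 1 - ε ≤ P.real {ω | x ω ∈ U})
    (hdim : PhaseRetrieval.lowerMinkowskiDim U < (m : EReal)) :
    ∀ᵐ A : Fin m → Fin n → ℝ ∂volume,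
      ∃ g : (Fin m → ℝ≥0) → EuclideanSpace ℝ (Fin n), Measurable g ∧
        P.real {ω | ¬ PhaseRetrieval.SignEquiv
          (g (PhaseRetrieval.phaseless (Matrix.of A) (x ω))) (x ω)} ≤ ε := by

  have hK : IsCompact (closure U) := hUb.isCompact_closure
  have hae : ∀ᵐ A : Fin m → Fin n → ℝ, ∀ᵐ u ∂(P.map x),
      PhaseRetrieval.Recoverable (closure U) A u := by
    have := Measure.isProbabilityMeasure_map (μ := P) hx.aemeasurable
    rw [Measure.ae_ae_comm (PhaseRetrieval.measurableSet_recoverable hK)]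
    exact Eventually.of_forall fun u => ae_all_iff.2 fun k =>
      PhaseRetrieval.ae_forall_not_confused hUb hdim Nat.one_div_pos_of_nat u
  filter_upwards [hae] with A hA
  obtain ⟨g, hg, hgK⟩ := PhaseRetrieval.exists_measurable_decoder hK A
  refine ⟨g, hg, ?_⟩
  have hKm : MeasurableSet {ω | x ω ∈ closure U} := hx hK.measurableSet
  calc P.real {ω | ¬ PhaseRetrieval.SignEquiv
          (g (PhaseRetrieval.phaseless (Matrix.of A) (x ω))) (x ω)}
      ≤ P.real {ω | x ω ∈ closure U}ᶜ := by
        refine ENNReal.toReal_mono (measure_ne_top _ _) (measure_mono_ae ?_)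
        filter_upwards [ae_of_ae_map hx.aemeasurable hA] with ω hω hne hmem
        exact hne (hgK _ hmem hω)
    _ = 1 - P.real {ω | x ω ∈ closure U} := probReal_compl_eq_one_sub hKm
    _ ≤ ε := by
        have : P.real {ω | x ω ∈ U} ≤ P.real {ω | x ω ∈ closure U} :=
          measureReal_mono fun ω hω => subset_closure hω
        linarith
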